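/- All digraphs are finite, without loops or parallel arcs; a tournament is a digraph in which each pair of distinct vertices is joined by precisely one arc. A path is a directed path (with pairwise distinct vertices), and its length is its number of arcs. A digraph $D$ is strong if for every ordered pair of vertices $u,v$ it contains a path from $u$ to $v$; it is $m$-strong if it has at least $m+1$ vertices and deleting any set of fewer than $m$ vertices leaves a strong digraph. A $2$-bypass of an arc $uv$ is a path of length $2$ from $u$ to $v$. A strong $m^*$-container between distinct vertices $u$ and $v$ is a set of $m$ distinct paths, either all from $u$ to $v$ or all from $v$ to $u$, such that no two of them share a vertex other than $u$ and $v$ and such that together they contain all vertices of $D$. A digraph is $m^*$-strongly connected if there is a strong $m^*$-container between any two distinct vertices. **Theorem.** Let $k\ge 2$ and let $T$ be a $(2k+1)$-strong tournament. If every arc of $T$ has at least one $2$-bypass, then $T$ is $(k+1)^*$-strongly connected. -/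

import Mathlib

namespace Digraph

variable {V : Type*}

/-- A tournament: no loops, and each pair of distinct vertices is joined by precisely one arc. -/
def IsTournament (D : Digraph V) : Prop :=
  (∀ v, ¬ D.Adj v v) ∧ ∀ u v, u ≠ v → (D.Adj u v ↔ ¬ D.Adj v u)

/-- The list `p` of pairwise distinct vertices is a directed path of `D` from `u` to `v`. -/
def IsDiPath (D : Digraph V) (u v : V) (p : List V) : Prop :=
  p.head? = some u ∧ p.getLast? = some v ∧ p.IsChain D.Adj ∧ p.Nodup

/-- `p` is an `m`-bypass of the arc `uv`: a directed path from `u` to `v` of length `m`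
(so with `m + 1` vertices), where `uv` is an arc. -/
def IsBypass (D : Digraph V) (m : ℕ) (u v : V) (p : List V) : Prop :=
  D.Adj u v ∧ D.IsDiPath u v p ∧ p.length = m + 1

/-- A digraph is strong if every vertex can be reached from every other by a directed path. -/
def IsStrong (D : Digraph V) : Prop :=
  ∀ u v, ∃ p, D.IsDiPath u v p

/-- The digraph obtained from `D` by deleting the vertices in `S`. -/
def deleteVertices (D : Digraph V) (S : Finset V) : Digraph {v : V // v ∉ S} where
  Adj a b := D.Adj a b

/-- `D` is `k`-strong: it has at least `k + 1` vertices, and deleting any set of fewer than `k`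
vertices leaves a strong digraph. -/
def IsKStrong [Fintype V] (D : Digraph V) (k : ℕ) : Prop :=
  k + 1 ≤ Fintype.card V ∧ ∀ S : Finset V, S.card < k → (D.deleteVertices S).IsStrong

/-- `C` is a set of `k` internally disjoint directed paths from `u` to `v`. -/
def IsDiContainer (D : Digraph V) (k : ℕ) (u v : V) (C : Finset (List V)) : Prop :=
  C.card = k ∧ (∀ p ∈ C, D.IsDiPath u v p) ∧
    ∀ p ∈ C, ∀ q ∈ C, p ≠ q → ∀ w, w ∈ p → w ∈ q → w = u ∨ w = v

/-- `C` is a strong `k*`-container between `u` and `v`: it consists of `k` internally disjoint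
paths, either all from `u` to `v` or all from `v` to `u`, and contains all vertices of `D`. -/
def IsStrongSpanningContainer (D : Digraph V) (k : ℕ) (u v : V) (C : Finset (List V)) : Prop :=
  (D.IsDiContainer k u v C ∨ D.IsDiContainer k v u C) ∧ ∀ w, ∃ p ∈ C, w ∈ p

/-- `D` is `k*`-strongly connected: any two distinct vertices have a strong `k*`-container. -/
def IsSpanningStronglyConnected (D : Digraph V) (k : ℕ) : Prop :=
  ∀ u v, u ≠ v → ∃ C, D.IsStrongSpanningContainer k u v C

end Digraph

/-! For an arc ab, the arc itself serves as one path from a to b. It remains to cover all other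
vertices by k disjoint nonempty links: paths of T - {a, b} that start at an out-neighbour of a and
end at an in-neighbour of b.

Menger's theorem, in a form derived from Hall's theorem (`exists_isLinkFamily_of_le_card`), gives 2k
disjoint links. Choose 2k of them covering as many vertices as possible. A vertex w left out cannot
be inserted into any link, so each link consists of an initial part dominated by w followed by a
final part dominating w. The vertices left out lie on one path Q that can be entered from the family
and left towards it (`exists_isLink_mem_iff`).

In `IsLinkFamily.exists_spanning`, Q, whole or cut into two pieces, is threaded through two or three
links, which become a single one. At most two links are lost, and 2k - 2 ≥ k since k ≥ 2. Any
surplus is removed by interleaving two links into one, which a tournament always allows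
(`IsLink.merge`). -/

/-- A chain of `r` whose first element satisfies `I` and whose last element satisfies `O`. -/
def IsLink {α : Type*} (r : α → α → Prop) (I O : α → Prop) (p : List α) : Prop :=
  p.IsChain r ∧ (∀ x ∈ p.head?, I x) ∧ ∀ x ∈ p.getLast?, O x

/-! ### Merging links, and vertices that cannot be inserted -/

namespace IsLink

variable {α : Type*} {r : α → α → Prop} {I O : α → Prop}

/-- Two disjoint links can be merged when the elements of different links are comparable. -/
theorem merge : ∀ (p q : List α) (I : α → Prop), IsLink r I O p → IsLink r I O q →
    (∀ x ∈ p, ∀ y ∈ q, r x y ∨ r y x) → ∃ l, l.Perm (p ++ q) ∧ IsLink r I O l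
  | [], q, _, _, hq, _ => ⟨q, by simp, hq⟩
  | p, [], _, hp, _, _ => ⟨p, by simp, hp⟩
  | x :: p, y :: q, I, hp, hq, h => by
    obtain ⟨hp1, hp2, hp3⟩ := hp
    obtain ⟨hq1, hq2, hq3⟩ := hq
    rw [List.isChain_cons] at hp1 hq1
    -- As in merging sorted lists, the dominating head goes first. What follows must start at one of
    -- its successors, so the entrance condition changes in the recursion.
    rcases h x (by simp) y (by simp) with hxy | hxy
    · obtain ⟨l, hl, hl1, hl2, hl3⟩ := merge p (y :: q) (r x)
        ⟨hp1.2, hp1.1, fun z hz => hp3 z (by cases p <;> simp_all [List.getLast?_cons])⟩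
        ⟨List.isChain_cons.2 hq1, by simpa using hxy, hq3⟩
        (fun z hz w hw => h z (by simp [hz]) w hw)
      have hne : l ≠ [] := by rintro rfl; simpa using hl.length_eq
      refine ⟨x :: l, by simpa using hl, List.isChain_cons.2 ⟨hl2, hl1⟩, by simpa using hp2, ?_⟩
      intro z hz
      exact hl3 z (by obtain ⟨c, l', rfl⟩ := List.exists_cons_of_ne_nil hne; simpa using hz)
    · obtain ⟨l, hl, hl1, hl2, hl3⟩ := merge (x :: p) q (r y)
        ⟨List.isChain_cons.2 hp1, by simpa using hxy, hp3⟩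
        ⟨hq1.2, hq1.1, fun z hz => hq3 z (by cases q <;> simp_all [List.getLast?_cons])⟩
        (fun z hz w hw => h z hz w (by simp [hw]))
      have hne : l ≠ [] := by rintro rfl; simpa using hl.length_eq
      refine ⟨y :: l, ?_, List.isChain_cons.2 ⟨hl2, hl1⟩, by simpa using hq2, ?_⟩
      · exact (hl.cons y).trans List.perm_middle.symm
      · intro z hz
        exact hl3 z (by obtain ⟨c, l', rfl⟩ := List.exists_cons_of_ne_nil hne; simpa using hz)
  termination_by p q => p.length + q.length

/-- The vertex `w` cannot be inserted into the link `p`. -/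
def Stuck (r : α → α → Prop) (I O : α → Prop) (p : List α) (w : α) : Prop :=
  ∀ l, l.Perm (w :: p) → ¬ IsLink r I O l

/-- If y → w and z follows y, then w → z would allow w between them, so z → w. This propagates to
the end of the link, where an exit w could be appended. -/
theorem after_of_stuck {w : α} : ∀ (p₂ p₁ : List α) (y : α), IsLink r I O (p₁ ++ y :: p₂) →
    Stuck r I O (p₁ ++ y :: p₂) w → (∀ x ∈ p₁ ++ y :: p₂, r x w ∨ r w x) → r y w →
    (∀ z ∈ p₂, r z w) ∧ ¬ O w
  | [], p₁, y, hp, hs, hc, hy => by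
    refine ⟨by simp, fun hO => hs (p₁ ++ [y] ++ [w]) ?_ ⟨?_, ?_, by simpa using hO⟩⟩
    · exact List.perm_append_comm
    · exact List.isChain_append.2 ⟨hp.1, by simp, by simpa using hy⟩
    · intro x hx; exact hp.2.1 x (by cases p₁ <;> simpa using hx)
  | z :: p₂, p₁, y, hp, hs, hc, hy => by
    have hz : r z w := by
      refine (hc z (by simp)).resolve_right fun hz => hs (p₁ ++ y :: w :: z :: p₂) ?_ ⟨?_, ?_, ?_⟩
      · refine (List.Perm.append_left p₁ (List.Perm.swap w y _)).trans List.perm_middle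
      · have := hp.1
        rw [List.isChain_split] at this ⊢
        refine ⟨this.1, ?_⟩
        have h2 := this.2
        simp only [List.isChain_cons_cons] at h2 ⊢
        exact ⟨hy, hz, h2.2⟩
      · intro x hx; exact hp.2.1 x (by cases p₁ <;> simpa using hx)
      · intro x hx; exact hp.2.2 x (by simpa using hx)
    have e : p₁ ++ y :: z :: p₂ = (p₁ ++ [y]) ++ z :: p₂ := by simp
    rw [e] at hp hs hc
    have := after_of_stuck p₂ (p₁ ++ [y]) z hp hs hc hz
    exact ⟨by simpa [hz] using this.1, this.2⟩

variable {p : List α} {w : α}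

theorem getLast_of_stuck (hp : IsLink r I O p) (hs : Stuck r I O p w)
    (hc : ∀ x ∈ p, r x w ∨ r w x) {y : α} (hy : y ∈ p) (hyw : r y w) :
    (∀ z ∈ p.getLast?, r z w) ∧ ¬ O w := by
  obtain ⟨p₁, p₂, rfl⟩ := List.append_of_mem hy
  have := after_of_stuck p₂ p₁ y hp hs hc hyw
  refine ⟨fun z hz => ?_, this.2⟩
  have hz' : z ∈ y :: p₂ := List.mem_of_getLast? (by simpa using hz)
  rcases List.mem_cons.1 hz' with rfl | h
  exacts [hyw, this.1 z h]

theorem of_head_of_stuck (hp : IsLink r I O p) (hs : Stuck r I O p w)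
    (hc : ∀ x ∈ p, r x w ∨ r w x) {z : α} (hz : z ∈ p.head?) (hzw : r z w) :
    ∀ x ∈ p, r x w := by
  cases p with
  | nil => simp
  | cons y p =>
    obtain rfl : y = z := by simpa using hz
    simpa [hzw] using (after_of_stuck p [] y hp hs hc hzw).1

/-- An entrance w cannot be put in front of the link, so the first vertex dominates w, and then
every vertex does. If the link is empty, an entrance that is also an exit would be a link by itself.
-/
theorem of_start_of_stuck (hp : IsLink r I O p) (hs : Stuck r I O p w)
    (hc : ∀ x ∈ p, r x w ∨ r w x) (hI : I w) : (∀ x ∈ p, r x w) ∧ ¬ O w := by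
  cases p with
  | nil => exact ⟨by simp, fun hO => hs [w] (by simp) ⟨by simp, by simpa, by simpa⟩⟩
  | cons y p =>
    have hy : r y w := by
      refine (hc y (by simp)).resolve_right fun hy => hs (w :: y :: p) (by simp) ⟨?_, by simpa, ?_⟩
      · exact List.isChain_cons_cons.2 ⟨hy, hp.1⟩
      · intro x hx; exact hp.2.2 x (by simpa using hx)
    exact ⟨of_head_of_stuck hp hs hc (z := y) (by simp) hy,
      (getLast_of_stuck hp hs hc (y := y) (by simp) hy).2⟩

theorem append {q : List α} {J K : α → Prop} (hp : IsLink r I J p) (hq : IsLink r K O q)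
    (hp0 : p ≠ []) (hq0 : q ≠ [])
    (h : ∀ x ∈ p.getLast?, ∀ y ∈ q.head?, r x y) : IsLink r I O (p ++ q) := by
  refine ⟨List.isChain_append.2 ⟨hp.1, hq.1, h⟩, ?_, ?_⟩
  · rw [List.head?_append_of_ne_nil _ hp0]; exact hp.2.1
  · rw [List.getLast?_append_of_ne_nil _ hq0]; exact hq.2.2

end IsLink

/-! ### A Hamiltonian path from an entrance to an exit -/

/-- A tournament on a finite set `W` into which one can always enter, and which one can always
leave, has a Hamiltonian path that starts at an entrance and ends at an exit. -/
theorem exists_isLink_mem_iff {α : Type*} {r : α → α → Prop} {I O : α → Prop} (W : Finset α)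
    (hasymm : ∀ x y, r x y → ¬ r y x) (htot : ∀ x y, x ≠ y → r x y ∨ r y x)
    (hcov : ∀ w ∈ W, I w ∨ O w)
    (hin : ∀ X ⊆ W, X.Nonempty → ∃ x ∈ X, I x ∨ ∃ y ∈ W, y ∉ X ∧ r y x)
    (hout : ∀ X ⊆ W, X.Nonempty → ∃ x ∈ X, O x ∨ ∃ y ∈ W, y ∉ X ∧ r x y) :
    ∃ Q : List α, IsLink r I O Q ∧ Q.Nodup ∧ ∀ x, x ∈ Q ↔ x ∈ W := by
  classical
  let S : Set ℕ := {n | ∃ Q : List α, IsLink r I O Q ∧ Q.Nodup ∧ (∀ x ∈ Q, x ∈ W) ∧ Q.length = n}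
  have hS : BddAbove S := by
    refine ⟨W.card, ?_⟩
    rintro _ ⟨Q, -, hnd, hQW, rfl⟩
    rw [← List.toFinset_card_of_nodup hnd]
    exact Finset.card_le_card fun x hx => hQW x (by simpa using hx)
  -- The end conditions are vacuous for the empty list, so a longest link exists.
  have hS0 : S.Nonempty := ⟨0, [], ⟨by simp, by simp, by simp⟩, by simp, by simp, rfl⟩
  obtain ⟨Q, hQ, hnd, hQW, hlen⟩ := Nat.sSup_mem hS0 hS
  have hmax : ∀ Q' : List α, IsLink r I O Q' → Q'.Nodup → (∀ x ∈ Q', x ∈ W) →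
      Q'.length ≤ Q.length := fun Q' h1 h2 h3 => hlen ▸ le_csSup hS ⟨Q', h1, h2, h3, rfl⟩
  have hstuck : ∀ w ∈ W, w ∉ Q → IsLink.Stuck r I O Q w := by
    intro w hw hwQ l hl hlink
    have := hmax l hlink (hl.nodup_iff.2 (List.nodup_cons.2 ⟨hwQ, hnd⟩))
      (fun x hx => by
        rcases List.mem_cons.1 (hl.mem_iff.1 hx) with rfl | h
        exacts [hw, hQW x h])
    have h2 := hl.length_eq
    simp at h2; omega
  have hcmp : ∀ w, w ∉ Q → ∀ x ∈ Q, r x w ∨ r w x := fun w hw x hx =>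
    htot x w (fun h => hw (h ▸ hx))
  have hD : ∀ w ∈ W, w ∉ Q → ¬ O w := by
    by_contra! hcon
    obtain ⟨w₀, hw₀, hw₀Q, hw₀O⟩ := hcon
    -- Consider how the set of uncovered exits is entered. Being stuck excludes an entrance in it
    -- and an arc from Q. An arc y → x from an uncovered non-exit y remains; y is then an entrance
    -- dominated by all of Q, and Q, y, x is a longer link.
    obtain ⟨x, hx, hx'⟩ := hin (W.filter fun w => w ∉ Q ∧ O w) (Finset.filter_subset _ _)
      ⟨w₀, by simp [*]⟩
    simp only [Finset.mem_filter] at hx hx'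
    obtain ⟨hxW, hxQ, hxO⟩ := hx
    rcases hx' with hxI | ⟨y, hyW, hy, hyx⟩
    · exact (IsLink.of_start_of_stuck hQ (hstuck x hxW hxQ) (hcmp x hxQ) hxI).2 hxO
    · by_cases hyQ : y ∈ Q
      · exact (IsLink.getLast_of_stuck hQ (hstuck x hxW hxQ) (hcmp x hxQ) hyQ hyx).2 hxO
      · have hyI : I y := (hcov y hyW).resolve_right fun h => hy ⟨hyW, hyQ, h⟩
        have hall := (IsLink.of_start_of_stuck hQ (hstuck y hyW hyQ) (hcmp y hyQ) hyI).1
        have hxy : y ≠ x := by rintro rfl; exact hasymm _ _ hyx hyx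
        have := hmax (Q ++ [y, x]) ⟨?_, ?_, ?_⟩ ?_ ?_
        · simp at this
        · refine List.isChain_append.2 ⟨hQ.1, by simpa using hyx, ?_⟩
          intro z hz t ht
          obtain rfl : y = t := by simpa using ht
          exact hall z (List.mem_of_getLast? hz)
        · intro z hz
          cases Q with
          | nil => obtain rfl : y = z := by simpa using hz
                   exact hyI
          | cons c Q => exact hQ.2.1 z (by simpa using hz)
        · intro z hz
          obtain rfl : x = z := by simpa using hz
          exact hxO
        · refine hnd.append (by simpa using hxy) ?_
          simp [hyQ, hxQ]
        · intro z hz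
          simp only [List.mem_append, List.mem_cons, List.not_mem_nil, or_false] at hz
          rcases hz with h | rfl | rfl
          exacts [hQW z h, hyW, hxW]
  refine ⟨Q, hQ, hnd, fun x => ⟨hQW x, fun hx => ?_⟩⟩
  by_contra hxQ
  -- No uncovered vertex is an exit, so the uncovered set is left by an arc w → y into Q. But w is
  -- an entrance, hence dominated by all of Q.
  obtain ⟨w, hw, hw'⟩ := hout (W.filter fun w => w ∉ Q) (Finset.filter_subset _ _)
    ⟨x, by simp [*]⟩
  simp only [Finset.mem_filter] at hw hw'
  obtain ⟨hwW, hwQ⟩ := hw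
  rcases hw' with h | ⟨y, hyW, hy, hwy⟩
  · exact hD w hwW hwQ h
  · have hyQ : y ∈ Q := by by_contra h; exact hy ⟨hyW, h⟩
    have hwI := (hcov w hwW).resolve_right (hD w hwW hwQ)
    exact hasymm _ _ hwy
      ((IsLink.of_start_of_stuck hQ (hstuck w hwW hwQ) (hcmp w hwQ) hwI).1 y hyQ)

/-! ### Families of links, and absorbing the remaining vertices -/

/-- A family of disjoint nonempty links. -/
def IsLinkFamily {α : Type*} (r : α → α → Prop) (I O : α → Prop) (L : List (List α)) : Prop :=
  (∀ p ∈ L, p ≠ [] ∧ IsLink r I O p) ∧ L.flatten.Nodup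

namespace IsLinkFamily

variable {α : Type*} {r : α → α → Prop} {I O : α → Prop} {L L' : List (List α)}

theorem nodup (h : IsLinkFamily r I O L) : L.Nodup := by
  have h1 := (List.nodup_flatten.1 h.2).2
  refine List.Pairwise.imp_of_mem ?_ h1
  rintro p q hp - hd rfl
  exact (h.1 p hp).1 (List.eq_nil_iff_forall_not_mem.2 fun x hx => hd hx hx)

/-- Two paths of a family can be merged into one. -/
theorem exists_length_pred (htot : ∀ x y, x ≠ y → r x y ∨ r y x) {n : ℕ}
    (h : IsLinkFamily r I O L) (hn : L.length = n + 2) :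
    ∃ L', IsLinkFamily r I O L' ∧ L'.length = n + 1 ∧ L'.flatten.Perm L.flatten := by
  match L, hn with
  | p :: q :: L, hn =>
    have hnd := h.2
    simp only [List.flatten_cons] at hnd
    rw [← List.append_assoc] at hnd
    have hpq := List.disjoint_of_nodup_append (List.nodup_append'.1 hnd).1
    obtain ⟨l, hl, hlink⟩ := IsLink.merge p q I (h.1 p (by simp)).2 (h.1 q (by simp)).2
      (fun x hx y hy => htot x y (by rintro rfl; exact hpq hx hy))
    have hperm : (l :: L).flatten.Perm (p :: q :: L).flatten := by
      simp only [List.flatten_cons]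
      rw [← List.append_assoc]
      exact hl.append_right _
    refine ⟨l :: L, ⟨?_, hperm.nodup_iff.2 h.2⟩, by simpa using hn, hperm⟩
    intro s hs
    rcases List.mem_cons.1 hs with rfl | hs
    · refine ⟨?_, hlink⟩
      rintro rfl
      have := hl.length_eq
      have h1 := List.length_pos_iff.2 (h.1 p (by simp)).1
      simp only [List.length_nil, List.length_append] at this
      omega
    · exact h.1 s (by simp [hs])

theorem exists_length_eq (htot : ∀ x y, x ≠ y → r x y ∨ r y x) {k : ℕ} (hk : 1 ≤ k)
    (n : ℕ) : ∀ L, IsLinkFamily r I O L → L.length = k + n →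
    ∃ L', IsLinkFamily r I O L' ∧ L'.length = k ∧ L'.flatten.Perm L.flatten := by
  induction n with
  | zero => exact fun L h hL => ⟨L, h, hL, .refl _⟩
  | succ n ih =>
    intro L h hL
    -- The truncated subtraction is harmless because k ≥ 1.
    obtain ⟨L₁, h₁, hL₁, hp₁⟩ := h.exists_length_pred htot (n := k + n - 1) (by omega)
    obtain ⟨L₂, h₂, hL₂, hp₂⟩ := ih L₁ h₁ (by omega)
    exact ⟨L₂, h₂, hL₂, hp₂.trans hp₁⟩

theorem exists_max [Fintype α] (h : IsLinkFamily r I O L) :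
    ∃ M, IsLinkFamily r I O M ∧ M.length = L.length ∧
      ∀ M', IsLinkFamily r I O M' → M'.length = L.length →
        M'.flatten.length ≤ M.flatten.length := by
  classical
  let S : Set ℕ := {n | ∃ M, IsLinkFamily r I O M ∧ M.length = L.length ∧ M.flatten.length = n}
  have hS : BddAbove S := by
    refine ⟨Fintype.card α, ?_⟩
    rintro _ ⟨M, hM, -, rfl⟩
    exact hM.2.length_le_card
  obtain ⟨M, hM, hlen, hsup⟩ := Nat.sSup_mem (s := S) ⟨_, L, h, rfl, rfl⟩ hS
  exact ⟨M, hM, hlen, fun M' h1 h2 => hsup ▸ le_csSup hS ⟨M', h1, h2, rfl⟩⟩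

/-- Replacing the link p by one on p and w would keep the number of links and cover one more vertex.
-/
theorem stuck_of_max
    (h : IsLinkFamily r I O L) (hmax : ∀ M', IsLinkFamily r I O M' → M'.length = L.length →
        M'.flatten.length ≤ L.flatten.length) {w : α} (hw : w ∉ L.flatten)
    {p : List α} (hp : p ∈ L) : IsLink.Stuck r I O p w := by
  classical
  intro l hl hlink
  have hpe := List.perm_cons_erase hp
  have hperm : (l :: L.erase p).flatten.Perm (w :: L.flatten) := by
    refine List.Perm.trans ?_ (hpe.flatten.symm.cons w)
    simp only [List.flatten_cons]
    exact hl.append_right _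
  have := hmax (l :: L.erase p) ⟨?_, hperm.nodup_iff.2 (List.nodup_cons.2 ⟨hw, h.2⟩)⟩
    (by simpa using hpe.length_eq.symm)
  · have h2 := hperm.length_eq
    simp only [List.length_cons] at h2
    omega
  · intro s hs
    rcases List.mem_cons.1 hs with rfl | hs
    · exact ⟨by rintro rfl; simpa using hl.length_eq, hlink⟩
    · exact h.1 s (List.mem_of_mem_erase hs)

/-- In a strong tournament, a family of at least three disjoint links can be made to cover all
vertices at the cost of at most two links. -/
theorem exists_spanning [Fintype α] (hasymm : ∀ x y, r x y → ¬ r y x)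
    (htot : ∀ x y, x ≠ y → r x y ∨ r y x)
    (hstr : ∀ X : Finset α, X.Nonempty → (∃ y, y ∉ X) → ∃ x ∈ X, ∃ y, y ∉ X ∧ r x y)
    (h : IsLinkFamily r I O L) (h3 : 3 ≤ L.length) :
    ∃ M, IsLinkFamily r I O M ∧ L.length ≤ M.length + 2 ∧ ∀ x, x ∈ M.flatten := by
  classical
  obtain ⟨M, hM, hML, hmax⟩ := h.exists_max
  rw [← hML] at hmax h3 ⊢
  clear h hML
  have hstuck : ∀ {w}, w ∉ M.flatten → ∀ {p}, p ∈ M → IsLink.Stuck r I O p w :=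
    fun hw _ hp => hM.stuck_of_max hmax hw hp
  have hcmp : ∀ {w}, w ∉ M.flatten → ∀ {p}, p ∈ M → ∀ x ∈ p, r x w ∨ r w x :=
    fun hw p hp x hx => htot _ _ (by rintro rfl; exact hw (List.mem_flatten.2 ⟨p, hp, hx⟩))
  by_cases hall : ∀ x, x ∈ M.flatten
  · exact ⟨M, hM, by omega, hall⟩
  push Not at hall
  obtain ⟨w₀, hw₀⟩ := hall
  obtain ⟨p₀, hp₀⟩ := List.exists_mem_of_length_pos (l := M) (by omega)
  obtain ⟨u₀, hu₀⟩ := List.exists_mem_of_ne_nil _ (hM.1 p₀ hp₀).1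
  have hu₀M : u₀ ∈ M.flatten := List.mem_flatten.2 ⟨p₀, hp₀, hu₀⟩
  -- Here entrances and exits of the uncovered set are the vertices with an in-neighbour,
  -- respectively an out-neighbour, on the family.
  obtain ⟨Q, hQ, hQnd, hQW⟩ := exists_isLink_mem_iff (r := r)
    (I := fun w => ∃ u ∈ M.flatten, r u w) (O := fun w => ∃ u ∈ M.flatten, r w u)
    (Finset.univ.filter fun w => w ∉ M.flatten) hasymm htot
    (by
      intro w hw
      simp only [Finset.mem_filter, Finset.mem_univ, true_and] at hw
      exact (hcmp hw hp₀ u₀ hu₀).imp (fun h => ⟨u₀, hu₀M, h⟩) fun h => ⟨u₀, hu₀M, h⟩)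
    (by
      intro X hX ⟨x₀, hx₀⟩
      obtain ⟨y, hy, x, hx, hyx⟩ := hstr Xᶜ ⟨u₀, by
        simp only [Finset.mem_compl]
        intro hu
        exact (Finset.mem_filter.1 (hX hu)).2 hu₀M⟩ ⟨x₀, by simpa⟩
      simp only [Finset.mem_compl, not_not] at hx hy
      refine ⟨x, hx, ?_⟩
      by_cases hyM : y ∈ M.flatten
      · exact .inl ⟨y, hyM, hyx⟩
      · exact .inr ⟨y, by simpa using hyM, hy, hyx⟩)
    (by
      intro X hX hX0
      obtain ⟨x, hx, y, hy, hxy⟩ := hstr X hX0 ⟨u₀, by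
        intro hu
        exact (Finset.mem_filter.1 (hX hu)).2 hu₀M⟩
      refine ⟨x, hx, ?_⟩
      by_cases hyM : y ∈ M.flatten
      · exact .inl ⟨y, hyM, hxy⟩
      · exact .inr ⟨y, by simpa using hyM, hy, hxy⟩)
  simp only [Finset.mem_filter, Finset.mem_univ, true_and] at hQW
  have hQ0 : Q ≠ [] := List.ne_nil_of_mem ((hQW w₀).2 hw₀)
  -- absorbing `Q` into a link that is made of `Q` and some members of the family
  have habsorb : ∀ (A N : List (List α)) (l : List α), M.Perm (A ++ N) → A.length ≤ 3 →
      l.Perm (A.flatten ++ Q) → IsLink r I O l →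
      ∃ M', IsLinkFamily r I O M' ∧ M.length ≤ M'.length + 2 ∧ ∀ x, x ∈ M'.flatten := by
    intro A N l hMA hA hl hlink
    have hperm : (l :: N).flatten.Perm (M.flatten ++ Q) := by
      simp only [List.flatten_cons]
      refine (hl.append_right _).trans ?_
      rw [List.append_assoc]
      refine (List.perm_append_comm.append_left _).trans ?_
      rw [← List.append_assoc, ← List.flatten_append]
      exact hMA.flatten.symm.append_right _
    refine ⟨l :: N, ⟨?_, hperm.nodup_iff.2 (hM.2.append hQnd ?_)⟩, ?_, ?_⟩
    · intro s hs
      rcases List.mem_cons.1 hs with rfl | hs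
      · refine ⟨?_, hlink⟩
        rintro rfl
        have := hl.length_eq
        have h1 := List.length_pos_iff.2 hQ0
        simp only [List.length_nil, List.length_append] at this
        omega
      · exact hM.1 s (hMA.mem_iff.2 (by simp [hs]))
    · intro x hx hxQ
      exact (hQW x).1 hxQ hx
    · have := hMA.length_eq
      simp only [List.length_append] at this
      simp only [List.length_cons]
      omega
    · intro x
      rw [hperm.mem_iff, List.mem_append, hQW]
      exact em _
  -- the ends of `Q`
  obtain ⟨s, hs⟩ : ∃ s, s ∈ Q.head? := ⟨Q.head hQ0, by simp [List.head?_eq_some_head hQ0]⟩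
  obtain ⟨t, ht⟩ : ∃ t, t ∈ Q.getLast? :=
    ⟨Q.getLast hQ0, by simp [List.getLast?_eq_some_getLast hQ0]⟩
  have hsM := (hQW s).1 (List.mem_of_head? hs)
  have htM := (hQW t).1 (List.mem_of_getLast? ht)
  obtain ⟨u, hu, hus⟩ := hQ.2.1 s hs
  obtain ⟨v, hv, htv⟩ := hQ.2.2 t ht
  obtain ⟨p, hp, hup⟩ := List.mem_flatten.1 hu
  obtain ⟨q, hq, hvq⟩ := List.mem_flatten.1 hv
  have hlast : ∀ {w}, w ∉ M.flatten → ∀ {p}, p ∈ M → ∀ {y}, y ∈ p → r y w →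
      ∀ z ∈ p.getLast?, r z w := fun hw p hp y hy hyw =>
    (IsLink.getLast_of_stuck (hM.1 p hp).2 (hstuck hw hp) (hcmp hw hp) hy hyw).1
  have hhead : ∀ {w}, w ∉ M.flatten → ∀ {p}, p ∈ M → ∀ {y}, y ∈ p → r w y →
      ∀ z ∈ p.head?, r w z := by
    intro w hw p hp y hy hwy z hz
    refine (hcmp hw hp z (List.mem_of_head? hz)).resolve_left fun hzw => ?_
    exact hasymm _ _ hwy
      (IsLink.of_head_of_stuck (hM.1 p hp).2 (hstuck hw hp) (hcmp hw hp) hz hzw y hy)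
  -- for every vertex outside and every link, one can go one way or the other
  have hor : ∀ {w}, w ∉ M.flatten → ∀ {p}, p ∈ M →
      (∀ z ∈ p.getLast?, r z w) ∨ ∀ z ∈ p.head?, r w z := by
    intro w hw p hp
    obtain ⟨y, hy⟩ := List.exists_mem_of_ne_nil _ (hM.1 p hp).1
    exact (hcmp hw hp y hy).imp (hlast hw hp hy) (hhead hw hp hy)
  have hQl : IsLink r (fun _ => True) (fun _ => True) Q := ⟨hQ.1, by simp, by simp⟩
  have hpair : ∀ p ∈ M, ∀ q ∈ M, p ≠ q → ∃ N, M.Perm ([p, q] ++ N) := by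
    intro p hp q hq hpq
    have hq' : q ∈ M.erase p := (List.mem_erase_of_ne hpq.symm).2 hq
    exact ⟨(M.erase p).erase q,
      (List.perm_cons_erase hp).trans ((List.perm_cons_erase hq').cons p)⟩
  -- With distinct p and q, the new link is p, Q, q.
  have htwo : ∀ p ∈ M, ∀ q ∈ M, p ≠ q → (∀ z ∈ p.getLast?, r z s) → (∀ z ∈ q.head?, r t z) →
      ∃ M', IsLinkFamily r I O M' ∧ M.length ≤ M'.length + 2 ∧ ∀ x, x ∈ M'.flatten := by
    intro p hp q hq hpq h1 h2
    obtain ⟨N, hN⟩ := hpair p hp q hq hpq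
    refine habsorb [p, q] N (p ++ Q ++ q) hN (by simp) ?_ ?_
    · simp only [List.flatten_cons, List.flatten_nil, List.append_nil, List.append_assoc]
      exact List.perm_append_comm.append_left _
    · refine ((hM.1 p hp).2.append hQl (hM.1 p hp).1 hQ0 ?_).append (hM.1 q hq).2
        (by simp [hQ0]) (hM.1 q hq).1 ?_
      · intro x hx y hy
        obtain rfl : s = y := Option.mem_unique hs hy
        exact h1 x hx
      · intro x hx y hy
        rw [List.getLast?_append_of_ne_nil _ hQ0] at hx
        obtain rfl : t = x := Option.mem_unique ht hx
        exact h2 y hy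
  have hps := hlast hsM hp hup hus
  have hqt := hhead htM hq hvq htv
  by_cases hpq : p = q
  swap
  · exact htwo p hp q hq hpq hps hqt
  subst hpq
  -- two further links
  obtain ⟨p', hp', hpp', p'', hp'', hpp'', hp'p''⟩ :
      ∃ p' ∈ M, p ≠ p' ∧ ∃ p'' ∈ M, p ≠ p'' ∧ p' ≠ p'' := by
    have hcard : 1 < (M.toFinset.erase p).card := by
      rw [Finset.card_erase_of_mem (by simpa using hp), List.toFinset_card_of_nodup hM.nodup]
      omega
    obtain ⟨p', hp', p'', hp'', hne⟩ := Finset.one_lt_card.1 hcard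
    simp only [Finset.mem_erase, List.mem_toFinset] at hp' hp''
    exact ⟨p', hp'.2, hp'.1.symm, p'', hp''.2, hp''.1.symm, hne⟩
  by_cases hcase : ∃ q ∈ M, p ≠ q ∧ ((∀ z ∈ q.getLast?, r z s) ∨ ∀ z ∈ q.head?, r t z)
  · obtain ⟨q, hq, hpq, h1 | h1⟩ := hcase
    · exact htwo q hq p hp (Ne.symm hpq) h1 hqt
    · exact htwo p hp q hq hpq hps h1
  push Not at hcase
  -- The new link is p', Q₂, p, Q₁, p'': since t → p and p → s, the link p joins the end of Q to its
  -- start.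
  have hthree : ∀ p' ∈ M, ∀ p'' ∈ M, p ≠ p' → p ≠ p'' → p' ≠ p'' → ∀ Q₁ Q₂, Q = Q₁ ++ Q₂ →
      Q₁ ≠ [] → Q₂ ≠ [] → (∀ z ∈ p'.getLast?, ∀ x ∈ Q₂.head?, r z x) →
      (∀ x ∈ Q₁.getLast?, ∀ z ∈ p''.head?, r x z) →
      ∃ M', IsLinkFamily r I O M' ∧ M.length ≤ M'.length + 2 ∧ ∀ x, x ∈ M'.flatten := by
    intro p' hp' p'' hp'' h1 h2 h3 Q₁ Q₂ hQQ hQ₁ hQ₂ h4 h5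
    obtain ⟨N, hN⟩ : ∃ N, M.Perm ([p', p, p''] ++ N) := by
      have hq₁ : p ∈ M.erase p' := (List.mem_erase_of_ne h1).2 hp
      have hq₂ : p'' ∈ (M.erase p').erase p :=
        (List.mem_erase_of_ne h2.symm).2 ((List.mem_erase_of_ne h3.symm).2 hp'')
      exact ⟨((M.erase p').erase p).erase p'', (List.perm_cons_erase hp').trans
        (((List.perm_cons_erase hq₁).trans ((List.perm_cons_erase hq₂).cons p)).cons p')⟩
    have hchain := List.isChain_append.1 (hQQ ▸ hQ.1)
    have hl₁ : IsLink r (fun _ => True) (fun _ => True) Q₁ := ⟨hchain.1, by simp, by simp⟩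
    have hl₂ : IsLink r (fun _ => True) (fun _ => True) Q₂ := ⟨hchain.2.1, by simp, by simp⟩
    refine habsorb [p', p, p''] N (p' ++ Q₂ ++ p ++ Q₁ ++ p'') hN (by simp) ?_ ?_
    · subst hQQ
      rw [List.perm_iff_count]
      intro x
      simp only [List.flatten_cons, List.flatten_nil, List.append_nil, List.count_append]
      omega
    · have hp0 := (hM.1 p hp).1
      refine ((((hM.1 p' hp').2.append hl₂ (hM.1 p' hp').1 hQ₂ h4).append (hM.1 p hp).2
        (by simp [hQ₂]) hp0 ?_).append hl₁ (by simp [hp0]) hQ₁ ?_).append (hM.1 p'' hp'').2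
        (by simp [hQ₁]) (hM.1 p'' hp'').1 ?_
      · intro x hx y hy
        rw [List.getLast?_append_of_ne_nil _ hQ₂] at hx
        rw [hQQ, List.getLast?_append_of_ne_nil _ hQ₂] at ht
        obtain rfl : t = x := Option.mem_unique ht hx
        exact hqt y hy
      · intro x hx y hy
        rw [List.getLast?_append_of_ne_nil _ hp0] at hx
        rw [hQQ, List.head?_append_of_ne_nil _ hQ₁] at hs
        obtain rfl : s = y := Option.mem_unique hs hy
        exact hps x hx
      · intro x hx y hy
        rw [List.getLast?_append_of_ne_nil _ hQ₁] at hx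
        exact h5 x hx y hy
  -- the place where `Q` is cut
  obtain ⟨Q₁, x, y, Q₂, hQQ, hx, hy⟩ : ∃ Q₁ x y Q₂, Q = Q₁ ++ x :: y :: Q₂ ∧
      ¬ ((∀ z ∈ p'.getLast?, r z x) ∨ ∀ z ∈ p''.getLast?, r z x) ∧
      ((∀ z ∈ p'.getLast?, r z y) ∨ ∀ z ∈ p''.getLast?, r z y) := by
    have key : ∀ (C : α → Prop) (Q : List α), (∀ s ∈ Q.head?, ¬ C s) → (∃ t ∈ Q, C t) →
        ∃ Q₁ x y Q₂, Q = Q₁ ++ x :: y :: Q₂ ∧ ¬ C x ∧ C y := by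
      intro C Q
      induction Q with
      | nil => simp
      | cons x Q ih =>
        intro h1 h2
        have hx : ¬ C x := h1 x (by simp)
        cases Q with
        | nil => simp [hx] at h2
        | cons y Q =>
          by_cases hy : C y
          · exact ⟨[], x, y, Q, rfl, hx, hy⟩
          · obtain ⟨Q₁, x', y', Q₂, h3, h4⟩ := ih (by simpa using hy) (by
              obtain ⟨t, ht, htC⟩ := h2
              exact ⟨t, (List.mem_cons.1 ht).resolve_left (by rintro rfl; exact hx htC), htC⟩)
            exact ⟨x :: Q₁, x', y', Q₂, by rw [h3]; rfl, h4⟩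
    -- The predicate fails at s, as neither p' nor p'' leads to s. It holds at t, as t does not lead
    -- to p', so p' must lead to t. Just before it first becomes true, x leads to both p' and p''.
    refine key (fun x => (∀ z ∈ p'.getLast?, r z x) ∨ ∀ z ∈ p''.getLast?, r z x) Q ?_
      ⟨t, List.mem_of_getLast? ht, .inl ?_⟩
    · intro s' hs'
      obtain rfl : s = s' := Option.mem_unique hs hs'
      rintro (h | h)
      · obtain ⟨⟨z, hz, hz'⟩, -⟩ := hcase p' hp' hpp'
        exact hz' (h z hz)
      · obtain ⟨⟨z, hz, hz'⟩, -⟩ := hcase p'' hp'' hpp''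
        exact hz' (h z hz)
    · refine (hor htM hp').resolve_right fun h => ?_
      obtain ⟨-, ⟨z, hz, hz'⟩⟩ := hcase p' hp' hpp'
      exact hz' (h z hz)
  have hxM := (hQW x).1 (by simp [hQQ])
  push Not at hx
  have hxhead : ∀ q ∈ M, (∃ z ∈ q.getLast?, ¬ r z x) → ∀ z ∈ q.head?, r x z := by
    rintro q hq ⟨z, hz, hz'⟩
    exact (hor hxM hq).resolve_left fun h => hz' (h z hz)
  have hQQ' : Q = (Q₁ ++ [x]) ++ y :: Q₂ := by simp [hQQ]
  rcases hy with hy | hy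
  · exact hthree p' hp' p'' hp'' hpp' hpp'' hp'p'' _ _ hQQ' (by simp) (by simp)
      (by simpa using hy) (by simpa using hxhead p'' hp'' hx.2)
  · exact hthree p'' hp'' p' hp' hpp'' hpp' hp'p''.symm _ _ hQQ' (by simp) (by simp)
      (by simpa using hy) (by simpa using hxhead p' hp' hx.1)

end IsLinkFamily

/-! ### Menger's theorem for links, from Hall's theorem -/

/-- Following a successor function that is injective as far as it is defined, from distinct
starting points, yields disjoint links. -/
theorem exists_isLink_of_successor {α ι : Type*} [DecidableEq α] [DecidableEq ι]
    {r : α → α → Prop} {O : α → Prop}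
    (f : α → Option α) (hr : ∀ x y, f x = some y → y = x ∨ r x y) (hO : ∀ x, f x = none → O x)
    (hinj : ∀ x x' y, f x = some y → f x' = some y → x = x') (N : ℕ) :
    ∀ (U : Finset α) (e : ι → α), U.card = N → Function.Injective e → (∀ i, e i ∉ U) →
      (∀ i y, f (e i) = some y → y ∈ U) → (∀ x ∈ U, ∀ y, f x = some y → y ∈ U) →
      ∃ p : ι → List α, (∀ i, (p i).Nodup ∧ IsLink r (fun x => x = e i) O (p i) ∧ p i ≠ [] ∧
        ∀ x ∈ p i, x = e i ∨ x ∈ U) ∧ ∀ i j, i ≠ j → (p i).Disjoint (p j) := by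
  induction N with
  | zero =>
    intro U e hU he heU hfe _
    obtain rfl := Finset.card_eq_zero.1 hU
    refine ⟨fun i => [e i], fun i => ⟨by simp, ⟨by simp, by simp, ?_⟩, by simp, by simp⟩, ?_⟩
    · intro x hx
      obtain rfl : e i = x := by simpa using hx
      exact hO _ (Option.eq_none_iff_forall_ne_some.2 fun y hy => by simpa using hfe i y hy)
    · intro i j hij
      simpa using fun h => hij (he h).symm
  | succ N ih =>
    intro U e hU he heU hfe hfU
    by_cases hend : ∀ i, f (e i) = none
    · refine ⟨fun i => [e i], fun i => ⟨by simp, ⟨by simp, by simp, ?_⟩, by simp, by simp⟩, ?_⟩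
      · intro x hx
        obtain rfl : e i = x := by simpa using hx
        exact hO _ (hend i)
      · intro i j hij
        simpa using fun h => hij (he h).symm
    push Not at hend
    obtain ⟨i₀, hi₀⟩ := hend
    obtain ⟨u, hu⟩ := Option.ne_none_iff_exists'.1 hi₀
    have huU := hfe i₀ u hu
    have hue : ∀ i, e i ≠ u := fun i h => heU i (h ▸ huU)
    -- Advance one starting point to its successor u, and prepend the old one to the path obtained.
    -- By injectivity u is not reached again.
    obtain ⟨p, hp, hdisj⟩ := ih (U.erase u) (Function.update e i₀ u)
      (by rw [Finset.card_erase_of_mem huU, hU]; rfl)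
      (by
        intro i j hij
        by_cases hi : i = i₀ <;> by_cases hj : j = i₀
        · rw [hi, hj]
        · subst hi; simp [hj] at hij; exact absurd hij.symm (hue j)
        · subst hj; simp [hi] at hij; exact absurd hij (hue i)
        · simp [hi, hj] at hij; exact he hij)
      (by
        intro i
        by_cases hi : i = i₀
        · subst hi; simp
        · simp [hi, heU])
      (by
        intro i y hy
        by_cases hi : i = i₀
        · subst hi
          simp only [Function.update_self] at hy
          refine Finset.mem_erase.2 ⟨?_, hfU u huU y hy⟩
          rintro rfl
          exact hue i (hinj _ _ _ hu hy)
        · simp only [ne_eq, hi, not_false_eq_true, Function.update_of_ne] at hy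
          refine Finset.mem_erase.2 ⟨?_, hfe i y hy⟩
          rintro rfl
          exact hi (he (hinj _ _ _ hy hu)))
      (by
        intro x hx y hy
        refine Finset.mem_erase.2 ⟨?_, hfU x (Finset.mem_of_mem_erase hx) y hy⟩
        rintro rfl
        exact heU i₀ (hinj _ _ _ hy hu ▸ Finset.mem_of_mem_erase hx))
    have hnot : ∀ j, e i₀ ∈ p j → j = i₀ → False := by
      rintro j hj rfl
      rcases (hp j).2.2.2 _ hj with h | h
      · exact hue j (by simpa using h)
      · exact heU j (Finset.mem_of_mem_erase h)
    have hnot' : ∀ j, e i₀ ∉ p j := by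
      intro j hj
      by_cases h : j = i₀
      · exact hnot j hj h
      · rcases (hp j).2.2.2 _ hj with h' | h'
        · simp only [ne_eq, h, not_false_eq_true, Function.update_of_ne] at h'
          exact h (he h').symm
        · exact heU i₀ (Finset.mem_of_mem_erase h')
    refine ⟨Function.update p i₀ (e i₀ :: p i₀), fun i => ?_, fun i j hij => ?_⟩
    · by_cases hi : i = i₀
      · subst hi
        obtain ⟨h1, ⟨h2, h3, h4⟩, h5, h6⟩ := hp i
        simp only [Function.update_self] at h3 h6 ⊢
        refine ⟨List.nodup_cons.2 ⟨hnot' i, h1⟩, ⟨List.isChain_cons.2 ⟨?_, h2⟩, by simp, ?_⟩,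
          by simp, ?_⟩
        · intro y hy
          rw [h3 y hy]
          exact (hr _ _ hu).resolve_left fun h => hue i h.symm
        · intro x hx
          obtain ⟨c, l, hl⟩ := List.exists_cons_of_ne_nil h5
          exact h4 x (by simpa [hl] using hx)
        · intro x hx
          rcases List.mem_cons.1 hx with h | h
          · exact .inl h
          · rcases h6 x h with rfl | h
            · exact .inr huU
            · exact .inr (Finset.mem_of_mem_erase h)
      · have := hp i
        simp only [ne_eq, hi, not_false_eq_true, Function.update_of_ne] at this ⊢
        exact ⟨this.1, this.2.1, this.2.2.1,
          fun x hx => (this.2.2.2 x hx).imp_right Finset.mem_of_mem_erase⟩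
    · by_cases hi : i = i₀ <;> by_cases hj : j = i₀
      · exact absurd (hi.trans hj.symm) hij
      · subst hi
        simp only [ne_eq, hj, not_false_eq_true, Function.update_of_ne, Function.update_self]
        exact List.disjoint_cons_left.2 ⟨hnot' j, hdisj i j hij⟩
      · subst hj
        simp only [ne_eq, hi, not_false_eq_true, Function.update_of_ne, Function.update_self]
        exact List.disjoint_cons_right.2 ⟨hnot' i, hdisj i j hij⟩
      · simpa [hi, hj] using hdisj i j hij

/-- Menger's theorem for links: there are `n` disjoint links if every set without exits has at
least `n` vertices outside it that are entrances or successors of its elements. -/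
theorem exists_isLinkFamily_of_le_card {α : Type*} [Fintype α] [DecidableEq α]
    {r : α → α → Prop} {I O : α → Prop}
    (n : ℕ) (hcut : ∀ X S : Finset α, (∀ x ∈ X, ¬ O x) →
      (∀ y, y ∉ X → (I y ∨ ∃ x ∈ X, r x y) → y ∈ S) → n ≤ S.card) :
    ∃ L, IsLinkFamily r I O L ∧ L.length = n := by
  classical
  -- The left side has n sources and the tails of arcs, the right side the heads of arcs and n
  -- sinks. Matching x with itself means that x lies on no link.
  let E : Fin n ⊕ α → α ⊕ Fin n → Prop := fun z w =>
    match z, w with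
    | .inl _, .inl y => I y
    | .inl _, .inr _ => False
    | .inr x, .inl y => y = x ∨ r x y
    | .inr x, .inr _ => O x
  have hall : ∀ s : Finset (Fin n ⊕ α),
      s.card ≤ (s.biUnion fun z => Finset.univ.filter (E z)).card := by
    intro s
    set X := s.toRight with hX
    have hs : s.card = s.toLeft.card + X.card := (Finset.card_toLeft_add_card_toRight).symm
    have hleft : s.toLeft.card ≤ n := by simpa using Finset.card_le_univ s.toLeft
    rw [hs]
    -- If X has an exit, all n sinks are neighbours. Without sources, X is matched with itself.
    -- Otherwise the cut S supplies n neighbours besides X.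
    by_cases hXO : ∃ x ∈ X, O x
    · obtain ⟨x, hx, hxO⟩ := hXO
      have hsub : X.disjSum Finset.univ ⊆ s.biUnion fun z => Finset.univ.filter (E z) := by
        intro w hw
        simp only [Finset.mem_biUnion, Finset.mem_filter, Finset.mem_univ, true_and]
        rcases w with y | j
        · exact ⟨.inr y, Finset.mem_toRight.1 (Finset.inl_mem_disjSum.1 hw), .inl rfl⟩
        · exact ⟨.inr x, Finset.mem_toRight.1 hx, hxO⟩
      have := Finset.card_le_card hsub
      simp only [Finset.card_disjSum, Finset.card_univ, Fintype.card_fin] at this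
      omega
    push Not at hXO
    by_cases hl : s.toLeft = ∅
    · have hsub : X.disjSum ∅ ⊆ s.biUnion fun z => Finset.univ.filter (E z) := by
        intro w hw
        simp only [Finset.mem_biUnion, Finset.mem_filter, Finset.mem_univ, true_and]
        rcases w with y | j
        · exact ⟨.inr y, Finset.mem_toRight.1 (Finset.inl_mem_disjSum.1 hw), .inl rfl⟩
        · simp at hw
      have := Finset.card_le_card hsub
      simp only [Finset.card_disjSum, Finset.card_empty] at this
      simp only [hl, Finset.card_empty]
      omega
    · obtain ⟨i, hi⟩ := Finset.nonempty_iff_ne_empty.2 hl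
      set S := Finset.univ.filter fun y => y ∉ X ∧ (I y ∨ ∃ x ∈ X, r x y) with hS
      have hSn : n ≤ S.card := hcut X S hXO fun y hy h => by simp [hS, hy, h]
      have hdisj : Disjoint X S := by
        rw [Finset.disjoint_left]
        intro x hx hxS
        exact (Finset.mem_filter.1 hxS).2.1 hx
      have hsub : (X ∪ S).disjSum ∅ ⊆ s.biUnion fun z => Finset.univ.filter (E z) := by
        intro w hw
        simp only [Finset.mem_biUnion, Finset.mem_filter, Finset.mem_univ, true_and]
        rcases w with y | j
        · rcases Finset.mem_union.1 (by simpa using hw) with h | h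
          · exact ⟨.inr y, Finset.mem_toRight.1 h, .inl rfl⟩
          · obtain ⟨-, -, h | ⟨x, hx, hxy⟩⟩ := Finset.mem_filter.1 h
            · exact ⟨.inl i, Finset.mem_toLeft.1 hi, h⟩
            · exact ⟨.inr x, Finset.mem_toRight.1 hx, .inr hxy⟩
        · simp at hw
      have := Finset.card_le_card hsub
      simp only [Finset.card_disjSum, Finset.card_empty, Finset.card_union_of_disjoint hdisj] at this
      omega
  obtain ⟨F, hF, hFE⟩ := (Finset.all_card_le_biUnion_card_iff_exists_injective _).1 hall
  simp only [Finset.mem_filter, Finset.mem_univ, true_and] at hFE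
  have hstart : ∀ i, ∃ y, F (.inl i) = .inl y ∧ I y := by
    intro i
    have := hFE (.inl i)
    rcases h : F (.inl i) with y | j
    · rw [h] at this; exact ⟨y, rfl, this⟩
    · rw [h] at this; exact this.elim
  choose e he heI using hstart
  have hf : ∀ x y, (F (.inr x)).getLeft? = some y ↔ F (.inr x) = .inl y := by
    intro x y; exact Sum.getLeft?_eq_some_iff
  have heinj : Function.Injective e := by
    intro i j hij
    have := hF ((he i).trans (by rw [hij, he j]))
    simpa using this
  have havoid : ∀ x y, (F (.inr x)).getLeft? = some y →
      y ∈ Finset.univ.filter fun y => ∀ i, e i ≠ y := by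
    intro x y h
    simp only [Finset.mem_filter, Finset.mem_univ, true_and]
    rintro i rfl
    have := hF (((hf _ _).1 h).trans (he i).symm)
    simp at this
  obtain ⟨p, hp, hdisj⟩ := exists_isLink_of_successor (r := r) (O := O)
    (fun x => (F (.inr x)).getLeft?)
    (by
      intro x y h
      have := hFE (.inr x)
      rw [(hf x y).1 h] at this
      exact this)
    (by
      intro x h
      have := hFE (.inr x)
      rcases h' : F (.inr x) with y | j
      · simp [h'] at h
      · rw [h'] at this; exact this)
    (by
      intro x x' y h h'
      have := hF (((hf _ _).1 h).trans ((hf _ _).1 h').symm)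
      simpa using this)
    _ (Finset.univ.filter fun y => ∀ i, e i ≠ y) e rfl heinj (by simp)
    (fun i y h => havoid _ y h) (fun x _ y h => havoid x y h)
  refine ⟨List.ofFn p, ⟨?_, List.nodup_flatten.2 ⟨?_, ?_⟩⟩, by simp⟩
  · intro l hl
    obtain ⟨i, rfl⟩ := (List.mem_ofFn' _ _).1 hl
    obtain ⟨-, h2, h3, -⟩ := hp i
    exact ⟨h3, h2.1, fun x hx => h2.2.1 x hx ▸ heI i, h2.2.2⟩
  · intro l hl
    obtain ⟨i, rfl⟩ := (List.mem_ofFn' _ _).1 hl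
    exact (hp i).1
  · rw [List.pairwise_ofFn]
    exact fun i j hij => hdisj i j hij.ne

/-! ### Application to the tournament -/

theorem List.IsChain.exists_boundary {α : Type*} {r : α → α → Prop} (P : α → Prop) {z : α} :
    ∀ {l : List α} {x : α}, l.IsChain r → x ∈ l.head? → z ∈ l.getLast? → P x → ¬ P z →
      ∃ x y, P x ∧ ¬ P y ∧ r x y
  | [], x, _, hx, _, _, _ => by simp at hx
  | [w], x, _, hx, hz, h, h' => by simp_all
  | w :: y :: l, x, hc, hx, hz, h, h' => by
    obtain rfl : w = x := by simpa using hx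
    rw [List.isChain_cons_cons] at hc
    by_cases hy : P y
    · exact hc.2.exists_boundary P (x := y) (by simp) (by simpa using hz) hy h'
    · exact ⟨w, y, h, hy, hc.1⟩

namespace Digraph

variable {V : Type*} {T : Digraph V}

theorem IsTournament.asymm (hT : T.IsTournament) {x y : V} (h : T.Adj x y) : ¬ T.Adj y x :=
  (hT.2 x y (by rintro rfl; exact hT.1 x h)).1 h

theorem IsTournament.total (hT : T.IsTournament) {x y : V} (h : x ≠ y) :
    T.Adj x y ∨ T.Adj y x := by
  by_cases h' : T.Adj y x
  · exact .inr h'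
  · exact .inl ((hT.2 x y h).2 h')

variable [Fintype V]

/-- After deleting fewer than `m` vertices from an `m`-strong digraph, every proper nonempty set
of the remaining vertices is left by an arc. -/
theorem IsKStrong.exists_adj_out {m : ℕ} (hT : T.IsKStrong m) (S : Finset V)
    (hS : S.card < m) (P : V → Prop) {x z : V} (hx : x ∉ S) (hz : z ∉ S) (hPx : P x)
    (hPz : ¬ P z) : ∃ x y, P x ∧ y ∉ S ∧ ¬ P y ∧ T.Adj x y := by
  obtain ⟨p, h1, h2, h3, -⟩ := hT.2 S hS ⟨x, hx⟩ ⟨z, hz⟩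
  obtain ⟨c, d, hc, hd, hcd⟩ := h3.exists_boundary (fun v => P v.1) h1 h2 hPx hPz
  exact ⟨c.1, d.1, hc, d.2, hd, hcd⟩

/-- In a `(2k+1)`-strong tournament, `k` disjoint paths of length at least two from the tail to
the head of an arc can be chosen so as to cover all vertices. -/
theorem IsTournament.exists_spanning_isLinkFamily (hT : T.IsTournament) {k : ℕ} (hk : 2 ≤ k)
    (hs : T.IsKStrong (2 * k + 1)) {a b : V} (hab : T.Adj a b) :
    ∃ L : List (List {v : V // v ≠ a ∧ v ≠ b}),
      IsLinkFamily (fun x y => T.Adj x.1 y.1) (fun x => T.Adj a x.1) (fun x => T.Adj x.1 b) L ∧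
      L.length = k ∧ ∀ x, x ∈ L.flatten := by
  classical
  have hne : a ≠ b := by rintro rfl; exact hT.1 a hab
  have hcard {S : Finset {v : V // v ≠ a ∧ v ≠ b}} (hS : S.card < 2 * k) (c : V) :
      (insert c (S.map (Function.Embedding.subtype _))).card < 2 * k + 1 := by
    have := Finset.card_insert_le c (S.map (Function.Embedding.subtype _))
    rw [Finset.card_map] at this
    omega
  obtain ⟨L, hL, hlen⟩ := exists_isLinkFamily_of_le_card
    (r := fun x y : {v : V // v ≠ a ∧ v ≠ b} => T.Adj x.1 y.1) (I := fun x => T.Adj a x.1)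
    (O := fun x => T.Adj x.1 b) (2 * k) (by
      intro X S hX hXS
      by_contra! hSk
      have hmem : ∀ {y : {v : V // v ≠ a ∧ v ≠ b}} {c : V},
          y.1 ∉ insert c (S.map (Function.Embedding.subtype _)) → y ∉ S :=
        fun hy hyS => hy (Finset.mem_insert_of_mem (Finset.mem_map_of_mem _ hyS))
      have hend : ∀ {c d : V}, (c = a ∨ c = b) → c ≠ d →
          c ∉ insert d (S.map (Function.Embedding.subtype _)) := by
        intro c d hc hcd h
        rcases Finset.mem_insert.1 h with h | h
        · exact hcd h
        · obtain ⟨y, -, rfl⟩ := Finset.mem_map.1 h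
          exact hc.elim y.2.1 y.2.2
      -- Deleting S and b leaves a an out-neighbour x₀, which lies in X. Deleting S and a instead,
      -- the path from x₀ to b must leave X, at a vertex that belongs to S or from an exit in X: a
      -- contradiction. Each time at most 2k vertices are deleted.
      obtain ⟨x₀, hx₀, hx₀S⟩ : ∃ x : {v : V // v ≠ a ∧ v ≠ b}, T.Adj a x.1 ∧ x ∉ S := by
        obtain ⟨z, hz⟩ : ∃ z, z ∉ insert a (insert b (S.map (Function.Embedding.subtype _))) := by
          by_contra! h
          have h1 := Finset.card_le_card (fun x _ => h x : Finset.univ ⊆ _)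
          have h2 := Finset.card_insert_le a (insert b (S.map (Function.Embedding.subtype _)))
          have h3 := hcard hSk b
          have h4 := hs.1
          rw [Finset.card_univ] at h1
          omega
        rw [Finset.mem_insert, not_or] at hz
        obtain ⟨x, y, rfl, hyS, hya, hxy⟩ := hs.exists_adj_out _ (hcard hSk b) (fun v => v = a)
          (hend (.inl rfl) hne) hz.2 rfl hz.1
        have hyb : y ≠ b := by rintro rfl; exact hyS (Finset.mem_insert_self _ _)
        exact ⟨⟨y, hya, hyb⟩, hxy, hmem (c := b) hyS⟩
      have hx₀X : x₀ ∈ X := by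
        by_contra h
        exact hx₀S (hXS x₀ h (.inl hx₀))
      obtain ⟨_, y, ⟨x, hx, rfl⟩, hyS, hyX, hxy⟩ := hs.exists_adj_out _ (hcard hSk a)
        (fun v => ∃ x ∈ X, x.1 = v) (x := x₀.1) (z := b)
        (by
          intro h
          rcases Finset.mem_insert.1 h with h | h
          · exact x₀.2.1 h
          · obtain ⟨y, hy, hyx⟩ := Finset.mem_map.1 h
            exact hx₀S (Subtype.ext hyx ▸ hy))
        (hend (.inr rfl) hne.symm) ⟨x₀, hx₀X, rfl⟩ (by rintro ⟨x, -, hx⟩; exact x.2.2 hx)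
      have hya : y ≠ a := by rintro rfl; exact hyS (Finset.mem_insert_self _ _)
      have hyb : y ≠ b := by rintro rfl; exact hX x hx hxy
      exact hmem (y := ⟨y, hya, hyb⟩) hyS
        (hXS ⟨y, hya, hyb⟩ (fun h => hyX ⟨_, h, rfl⟩) (.inr ⟨x, hx, hxy⟩)))
  have htot : ∀ x y : {v : V // v ≠ a ∧ v ≠ b}, x ≠ y → T.Adj x.1 y.1 ∨ T.Adj y.1 x.1 :=
    fun x y h => hT.total fun h' => h (Subtype.ext h')
  obtain ⟨M, hM, hMlen, hMall⟩ := hL.exists_spanning (fun x y h => hT.asymm h) htot (by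
      rintro X ⟨x₀, hx₀⟩ ⟨z, hz⟩
      have hnot : ∀ x : {v : V // v ≠ a ∧ v ≠ b}, x.1 ∉ ({a, b} : Finset V) := by
        rintro x h
        simp only [Finset.mem_insert, Finset.mem_singleton] at h
        exact h.elim x.2.1 x.2.2
      obtain ⟨_, y, ⟨x, hx, rfl⟩, hy, hyX, hxy⟩ := hs.exists_adj_out {a, b}
        (Finset.card_le_two.trans_lt (by omega)) (fun v => ∃ x ∈ X, x.1 = v) (hnot x₀) (hnot z)
        ⟨x₀, hx₀, rfl⟩ (by rintro ⟨x, hx, h⟩; exact hz (Subtype.ext h ▸ hx))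
      simp only [Finset.mem_insert, Finset.mem_singleton, not_or] at hy
      exact ⟨x, hx, ⟨y, hy⟩, fun h => hyX ⟨_, h, rfl⟩, hxy⟩)
    (by omega)
  -- At least 2k - 2 ≥ k links are left, so merging can reach exactly k.
  obtain ⟨N, hN, hNlen, hNM⟩ :=
    IsLinkFamily.exists_length_eq htot (k := k) (by omega) (M.length - k) M hM (by omega)
  exact ⟨N, hN, hNlen, fun x => hNM.mem_iff.2 (hMall x)⟩

/-- In a `(2k+1)`-strong tournament, every arc has a spanning container of `k+1` paths from its
tail to its head, one of which is the arc itself; the bypasses of arcs play no role. -/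
theorem IsTournament.exists_isDiContainer (hT : T.IsTournament) {k : ℕ} (hk : 2 ≤ k)
    (hs : T.IsKStrong (2 * k + 1)) {a b : V} (hab : T.Adj a b) :
    ∃ C, T.IsDiContainer (k + 1) a b C ∧ ∀ w, ∃ p ∈ C, w ∈ p := by
  classical
  have hne : a ≠ b := by rintro rfl; exact hT.1 a hab
  obtain ⟨L, hL, hlen, hall⟩ := hT.exists_spanning_isLinkFamily hk hs hab
  let g : List {v : V // v ≠ a ∧ v ≠ b} → List V := fun p => a :: (p.map Subtype.val ++ [b])
  have hg : Function.Injective g := by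
    intro p q hpq
    exact List.map_injective_iff.2 Subtype.val_injective
      (List.append_cancel_right (List.cons.inj hpq).2)
  have hmem : ∀ {w p}, w ∈ g p → w = a ∨ w = b ∨ ∃ x ∈ p, x.1 = w := by
    intro w p hw
    simp only [g, List.mem_cons, List.mem_append, List.mem_map, List.not_mem_nil,
      or_false] at hw
    tauto
  -- Links are nonempty, so none of them yields the bare arc, and the k + 1 paths are distinct.
  have hab_notMem : [a, b] ∉ L.toFinset.image g := by
    intro h
    obtain ⟨p, hp, hpg⟩ := Finset.mem_image.1 h
    exact (hL.1 p (by simpa using hp)).1 (hg (hpg.trans (by simp [g]) : g p = g []))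
  refine ⟨insert [a, b] (L.toFinset.image g), ⟨?_, ?_, ?_⟩, ?_⟩
  · rw [Finset.card_insert_of_notMem hab_notMem, Finset.card_image_of_injective _ hg,
      List.toFinset_card_of_nodup hL.nodup, hlen]
  · intro q hq
    rcases Finset.mem_insert.1 hq with rfl | hq
    · exact ⟨by simp, by simp, by simpa using hab, by simpa using hne⟩
    · obtain ⟨p, hp, rfl⟩ := Finset.mem_image.1 hq
      have hp' : p ∈ L := by simpa using hp
      obtain ⟨hp0, hc, hI, hO⟩ := hL.1 p hp'
      refine ⟨by simp [g], ?_, ?_, ?_⟩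
      · rw [show g p = (a :: p.map Subtype.val) ++ [b] from rfl, List.getLast?_concat]
      · refine List.isChain_cons.2 ⟨?_, List.isChain_append.2 ⟨?_, by simp, ?_⟩⟩
        · intro y hy
          rw [List.head?_append_of_ne_nil _ (mt List.map_eq_nil_iff.1 hp0), List.head?_map] at hy
          obtain ⟨x, hx, rfl⟩ := Option.mem_map.1 hy
          exact hI x hx
        · exact (List.isChain_map _).2 hc
        · intro y hy z hz
          rw [List.getLast?_map] at hy
          obtain ⟨x, hx, rfl⟩ := Option.mem_map.1 hy
          obtain rfl : b = z := by simpa using hz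
          exact hO x hx
      · have hnd := ((List.nodup_flatten.1 hL.2).1 p hp').map Subtype.val_injective
        refine List.nodup_cons.2 ⟨?_, hnd.append (by simp) ?_⟩
        · simp [hne]
        · simp
  · have key : ∀ p ∈ L, ∀ q ∈ L, g p ≠ g q → ∀ w, w ∈ g p → w ∈ g q → w = a ∨ w = b := by
      intro p hp q hq hpq w hwp hwq
      rcases hmem hwp with h | h | ⟨x, hx, rfl⟩
      · exact .inl h
      · exact .inr h
      rcases hmem hwq with h | h | ⟨y, hy, hyx⟩
      · exact .inl h
      · exact .inr h
      obtain rfl := Subtype.ext hyx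
      have : Std.Symm (List.Disjoint (α := {v : V // v ≠ a ∧ v ≠ b})) := ⟨fun _ _ h => h.symm⟩
      have hd := (List.nodup_flatten.1 hL.2).2.forall hp hq (fun h => hpq (h ▸ rfl))
      exact (hd hx hy).elim
    intro p hp q hq hpq w hwp hwq
    rcases Finset.mem_insert.1 hp with rfl | hp
    · simpa using hwp
    rcases Finset.mem_insert.1 hq with rfl | hq
    · simpa using hwq
    obtain ⟨p, hpL, rfl⟩ := Finset.mem_image.1 hp
    obtain ⟨q, hqL, rfl⟩ := Finset.mem_image.1 hq
    exact key p (List.mem_toFinset.1 hpL) q (List.mem_toFinset.1 hqL) hpq w hwp hwq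
  · intro w
    by_cases hw : w ≠ a ∧ w ≠ b
    · obtain ⟨p, hp, hwp⟩ := List.mem_flatten.1 (hall ⟨w, hw⟩)
      refine ⟨g p, Finset.mem_insert_of_mem (Finset.mem_image_of_mem g (by simpa using hp)), ?_⟩
      refine List.mem_cons_of_mem _ (List.mem_append_left _ ?_)
      exact List.mem_map.2 ⟨_, hwp, rfl⟩
    · refine ⟨[a, b], Finset.mem_insert_self _ _, ?_⟩
      simp only [List.mem_cons, List.not_mem_nil, or_false]
      tauto

end Digraph

theorem mainTheorem4 {V : Type*} [Fintype V] (k : ℕ) (hk : 2 ≤ k) (T : Digraph V)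
    (hT : T.IsTournament) (hstrong : T.IsKStrong (2 * k + 1))
    (hbypass : ∀ u v, T.Adj u v → ∃ p, T.IsBypass 2 u v p) :
    T.IsSpanningStronglyConnected (k + 1) := by
  intro u v huv
  rcases hT.total huv with h | h
  · obtain ⟨C, hC, hall⟩ := hT.exists_isDiContainer hk hstrong h
    exact ⟨C, .inl hC, hall⟩
  · obtain ⟨C, hC, hall⟩ := hT.exists_isDiContainer hk hstrong h
    exact ⟨C, .inr hC, hall⟩
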